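/- The number $1$ is the only positive integer that is both a triangular number (a number of the form $T_n = n(n+1)/2$ with $n$ a natural number) and a perfect cube. Equivalently, the only pair $(n,m)$ of positive integers with $\frac{n(n+1)}{2} = m^3$ is $(n,m) = (1,1)$. -/

import Mathlib

/-- The `n`-th triangular number `T n = n (n + 1) / 2`. The division is exact, see
`triangular_eq_sum` and `two_mul_triangular`. -/
def triangular (n : ℕ) : ℕ := n * (n + 1) / 2

/-- The `n`-th triangular number is the sum of the natural numbers from `1` to `n`. -/
theorem triangular_eq_sum (n : ℕ) : triangular n = ∑ i ∈ Finset.Icc 1 n, i := by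
  induction n with
  | zero => simp [triangular]
  | succ k ih =>
    rw [Finset.sum_Icc_succ_top (by omega), ← ih]
    unfold triangular
    have h : (k + 1) * (k + 1 + 1) = k * (k + 1) + (k + 1) * 2 := by ring
    rw [h, Nat.add_mul_div_right _ _ (by norm_num)]

theorem two_mul_triangular (n : ℕ) : 2 * triangular n = n * (n + 1) :=
  Nat.mul_div_cancel' (Nat.even_mul_succ_self n).two_dvd

/-- A cubic-triangular number is a positive integer that is simultaneously a triangular number
and a perfect cube. -/
def IsCubicTriangular (N : ℕ) : Prop :=
  0 < N ∧ (∃ n : ℕ, N = triangular n) ∧ (∃ m : ℕ, N = m ^ 3)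

/-! Since `n` and `n + 1` are coprime, `n (n + 1) = 2 m ^ 3` makes one of them a cube and the other
twice a cube, so `a ^ 3 ± 1 = 2 b ^ 3`. This is a case of Euler's `x ^ 3 + y ^ 3 = 2 z ^ 3`, solved
by descent on `|z|`: with `x = p + q`, `y = p - q` it reads `p (p ^ 2 + 3 q ^ 2) = z ^ 3`. Up to
powers of 3 both factors are cubes, and unique factorization of Eisenstein integers writes `p + q
√-3` (or its analogue when `3 ∣ p`) as a cube `(u + v √-3) ^ 3`. Comparing coordinates yields three
coprime factors that are again cubes, forming a smaller solution. -/

open scoped QuadraticAlgebra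

/-- The Eisenstein integers, with `ω ^ 2 = -1 - ω`. -/
abbrev EisensteinInt := QuadraticAlgebra ℤ (-1) (-1)

/-! ### Euclidean division, units and cubes of Eisenstein integers -/

namespace EisensteinInt

theorem norm_eq (z : EisensteinInt) : z.norm = z.re ^ 2 - z.re * z.im + z.im ^ 2 := by
  rw [QuadraticAlgebra.norm_def]; ring

theorem norm_nonneg (z : EisensteinInt) : 0 ≤ z.norm := by
  rw [norm_eq]; nlinarith [sq_nonneg (z.re - z.im), sq_nonneg z.re, sq_nonneg z.im]

theorem norm_pos {z : EisensteinInt} (hz : z ≠ 0) : 0 < z.norm := by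
  refine lt_of_le_of_ne (norm_nonneg z) fun h => hz ?_
  rw [norm_eq] at h
  have hre : z.re = 0 := by
    nlinarith [sq_nonneg (2 * z.im - z.re), sq_nonneg z.re]
  have him : z.im = 0 := by
    rw [hre] at h
    nlinarith [sq_nonneg z.im]
  exact QuadraticAlgebra.ext hre him

/-- The quotient of two Eisenstein integers, with coordinates rounded to nearest integers. -/
def quot (x y : EisensteinInt) : EisensteinInt :=
  ⟨(2 * (x * star y).re + y.norm) / (2 * y.norm), (2 * (x * star y).im + y.norm) / (2 * y.norm)⟩

theorem abs_sub_mul_round_le (a : ℤ) {n : ℤ} (hn : 0 < n) :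
    |2 * (a - n * ((2 * a + n) / (2 * n)))| ≤ n := by
  have h1 := Int.emod_nonneg (2 * a + n) (b := 2 * n) (by omega)
  have h2 := Int.emod_lt_of_pos (2 * a + n) (b := 2 * n) (by omega)
  have h3 := Int.emod_add_mul_ediv (2 * a + n) (2 * n)
  rw [abs_le]
  constructor <;> nlinarith

theorem norm_sub_mul_quot_lt (x : EisensteinInt) {y : EisensteinInt} (hy : y ≠ 0) :
    (x - y * quot x y).norm < y.norm := by
  have hn := norm_pos hy
  have he := abs_sub_mul_round_le (x * star y).re hn
  have hf := abs_sub_mul_round_le (x * star y).im hn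
  have hmul : (x - y * quot x y) * star y = x * star y - (y.norm : EisensteinInt) * quot x y := by
    have := QuadraticAlgebra.algebraMap_norm_eq_mul_star y
    rw [show (y.norm : EisensteinInt) = algebraMap ℤ EisensteinInt y.norm from rfl, this]
    ring
  have hnorm : (x - y * quot x y).norm * y.norm =
      (x * star y - (y.norm : EisensteinInt) * quot x y).norm := by
    rw [← hmul, map_mul, QuadraticAlgebra.norm_star]
  rw [norm_eq (x * star y - _)] at hnorm
  have hre : (x * star y - (y.norm : EisensteinInt) * quot x y).re =
      (x * star y).re - y.norm * ((2 * (x * star y).re + y.norm) / (2 * y.norm)) := by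
    rw [QuadraticAlgebra.re_sub, QuadraticAlgebra.re_mul (y.norm : EisensteinInt)]
    simp [quot]
  have him : (x * star y - (y.norm : EisensteinInt) * quot x y).im =
      (x * star y).im - y.norm * ((2 * (x * star y).im + y.norm) / (2 * y.norm)) := by
    rw [QuadraticAlgebra.im_sub, QuadraticAlgebra.im_mul (y.norm : EisensteinInt)]
    simp [quot]
  rw [← hre] at he
  rw [← him] at hf
  generalize (x * star y - (y.norm : EisensteinInt) * quot x y).re = e at *
  generalize (x * star y - (y.norm : EisensteinInt) * quot x y).im = f at *
  have he2 := sq_le_sq' (abs_le.1 he).1 (abs_le.1 he).2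
  have hf2 := sq_le_sq' (abs_le.1 hf).1 (abs_le.1 hf).2
  refine lt_of_mul_lt_mul_right ?_ hn.le
  rw [hnorm]
  -- `e ^ 2 - e f + f ^ 2 ≤ 3/2 (e ^ 2 + f ^ 2) ≤ 3/4 N ^ 2`, where `N` is the norm of `y`.
  nlinarith [sq_nonneg (e + f), mul_pos hn hn]

theorem quot_zero (x : EisensteinInt) : quot x 0 = 0 := by
  ext <;> simp [quot]

instance : EuclideanDomain EisensteinInt :=
  { (inferInstance : CommRing EisensteinInt), (inferInstance : Nontrivial EisensteinInt) with
    quotient := quot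
    remainder := fun x y => x - y * quot x y
    quotient_zero := quot_zero
    quotient_mul_add_remainder_eq := fun _ _ => by ring
    r := _
    r_wellFounded := (measure fun z : EisensteinInt => z.norm.natAbs).wf
    remainder_lt := fun x y hy => by
      have h1 := norm_sub_mul_quot_lt x hy
      have h2 := norm_nonneg (x - y * quot x y)
      exact Int.natAbs_lt_natAbs_of_nonneg_of_lt h2 h1
    mul_left_not_lt := fun a b hb => by
      have h1 := norm_pos hb
      refine not_lt_of_ge (?_ : a.norm.natAbs ≤ (a * b).norm.natAbs)
      rw [map_mul, Int.natAbs_mul]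
      exact Nat.le_mul_of_pos_right _ (by omega) }

/-- The three shapes are `s`, `s ω` and `s ω ^ 2`; norm 1 confines both coordinates to `[-1, 1]`. -/
theorem unit_cases (ε : EisensteinIntˣ) :
    ∃ s : ℤ, (s = 1 ∨ s = -1) ∧ ((ε : EisensteinInt) = ⟨s, 0⟩ ∨ (ε : EisensteinInt) = ⟨0, s⟩ ∨
      (ε : EisensteinInt) = ⟨-s, -s⟩) := by
  have h : IsUnit (ε : EisensteinInt).norm := ε.isUnit.map _
  have h1 : (ε : EisensteinInt).norm = 1 := by
    rcases Int.isUnit_iff.1 h with h | h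
    · exact h
    · have := norm_nonneg (ε : EisensteinInt); omega
  generalize (ε : EisensteinInt) = z at *
  obtain ⟨a, b⟩ := z
  rw [norm_eq] at h1
  simp only at h1
  have ha : -1 ≤ a ∧ a ≤ 1 := by
    constructor <;> nlinarith [sq_nonneg (2 * b - a)]
  have hb : -1 ≤ b ∧ b ≤ 1 := by
    constructor <;> nlinarith [sq_nonneg (2 * a - b)]
  simp only [QuadraticAlgebra.mk.injEq]
  obtain ⟨ha1, ha2⟩ := ha
  obtain ⟨hb1, hb2⟩ := hb
  interval_cases a <;> interval_cases b <;> first | omega | exact ⟨1, by omega⟩ | exact ⟨-1, by omega⟩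

/-- The cube of an Eisenstein integer is the cube of an element of `ℤ[√-3]`. -/
theorem exists_cube_eq (d : EisensteinInt) :
    ∃ u v : ℤ, d ^ 3 = (⟨u + v, 2 * v⟩ : EisensteinInt) ^ 3 := by
  -- Since `ω ^ 3 = 1`, `d` may be replaced by `ω d` or `ω ^ 2 d`; one of the three has even
  -- `ω`-coordinate. Here `√-3 = 1 + 2 ω`, so `u + v √-3` is `⟨u + v, 2 * v⟩`.
  obtain ⟨a, b⟩ := d
  rcases Int.even_or_odd' b with ⟨k, rfl | rfl⟩
  · exact ⟨a - k, k, by simp⟩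
  rcases Int.even_or_odd' a with ⟨l, rfl | rfl⟩
  · refine ⟨2 * k + 1 - l, -l, ?_⟩
    ext <;> simp [pow_succ] <;> ring
  · refine ⟨-(k + l + 1), l - k, ?_⟩
    ext <;> simp [pow_succ] <;> ring

theorem cube_eq (u v : ℤ) : (⟨u + v, 2 * v⟩ : EisensteinInt) ^ 3 =
    ⟨u * (u ^ 2 - 9 * v ^ 2) + 3 * v * (u ^ 2 - v ^ 2), 2 * (3 * v * (u ^ 2 - v ^ 2))⟩ := by
  ext <;> simp [pow_succ] <;> ring

end EisensteinInt

/-! ### Euler's lemma -/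

open EisensteinInt in
/-- A version of Euler's lemma on cubes of the form `p ^ 2 + 3 * q ^ 2`. -/
theorem exists_of_sq_add_three_mul_sq_eq_cube {p q m : ℤ} (hpq : IsCoprime p q)
    (hodd : Odd (p + q)) (h3 : ¬ 3 ∣ p) (h : p ^ 2 + 3 * q ^ 2 = m ^ 3) :
    ∃ u v : ℤ, p = u * (u ^ 2 - 9 * v ^ 2) ∧ q = 3 * v * (u ^ 2 - v ^ 2) := by
  have h2m : IsCoprime (2 : ℤ) (m ^ 3) := by
    rw [Prime.coprime_iff_not_dvd Int.prime_two, ← h, ← even_iff_two_dvd, Int.not_even_iff_odd]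
    have : p ^ 2 + 3 * q ^ 2 = (p + q) ^ 2 + 2 * (q * (q - p)) := by ring
    rw [this]
    exact hodd.pow.add_even (even_two_mul _)
  have h3m : IsCoprime (3 : ℤ) (m ^ 3) := by
    rw [Prime.coprime_iff_not_dvd Int.prime_three, ← h]
    intro hd
    exact h3 (Int.prime_three.dvd_of_dvd_pow ((Int.dvd_add_left ⟨_, rfl⟩).1 hd))
  set α : EisensteinInt := ⟨p + q, 2 * q⟩ with hα
  have hmul : α * star α = (m : EisensteinInt) ^ 3 := by
    rw [← QuadraticAlgebra.algebraMap_norm_eq_mul_star, norm_eq]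
    have : (α.re ^ 2 - α.re * α.im + α.im ^ 2) = m ^ 3 := by
      rw [← h]; simp only [hα]; ring
    rw [this]; simp
  have hcop : IsCoprime α (star α) := by
    obtain ⟨r, s, hrs⟩ := hpq
    obtain ⟨a, b, hab⟩ := h2m.mul_left h3m
    -- The ideal of `α` and `star α` contains `2 p`, `√-3 (α - star α) = -6 q` and `m ^ 3`, hence 6
    -- and a number coprime to 6.
    have key : (a * (3 * r) : EisensteinInt) * (α + star α) -
        (a * s : EisensteinInt) * (⟨1, 2⟩ * (α - star α)) + b * (m : EisensteinInt) ^ 3 = 1 := by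
      have h1 : α + star α = ((2 * p : ℤ) : EisensteinInt) := by
        ext <;> simp [hα]; ring
      have h2 : (⟨1, 2⟩ * (α - star α) : EisensteinInt) = ((-(6 * q) : ℤ) : EisensteinInt) := by
        ext <;> simp [hα] <;> ring
      rw [h1, h2]
      norm_cast
      linear_combination hab + 6 * a * hrs
    rw [← hmul] at key
    refine ⟨a * (3 * r) - a * s * ⟨1, 2⟩ + b * star α, a * (3 * r) + a * s * ⟨1, 2⟩, ?_⟩
    rw [← key]; ring
  obtain ⟨d, ε, hd⟩ := exists_associated_pow_of_mul_eq_pow' hcop hmul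
  obtain ⟨u, v, huv⟩ := exists_cube_eq d
  obtain ⟨s, hs, hε⟩ := unit_cases ε
  rw [huv, cube_eq] at hd
  have hs2 : s ^ 2 = 1 := by rcases hs with rfl | rfl <;> norm_num
  rcases hε with hε | hε | hε <;> rw [hε] at hd <;>
    obtain ⟨h1, h2⟩ := QuadraticAlgebra.ext_iff.1 hd <;>
    simp only [hα, QuadraticAlgebra.re_mul, QuadraticAlgebra.im_mul] at h1 h2
  -- The sign is itself a cube, so it is absorbed; the units `± ω`, `± ω ^ 2` contradict the parity
  -- of `p + q`.
  · refine ⟨s * u, s * v, ?_, ?_⟩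
    · rcases hs with rfl | rfl <;> linarith
    · rcases hs with rfl | rfl <;> linarith
  · exfalso
    obtain ⟨k, hk⟩ := hodd
    generalize u * (u ^ 2 - 9 * v ^ 2) = U at *
    generalize 3 * v * (u ^ 2 - v ^ 2) = V at *
    rcases hs with rfl | rfl <;> omega
  · exfalso
    obtain ⟨k, hk⟩ := hodd
    generalize u * (u ^ 2 - 9 * v ^ 2) = U at *
    generalize 3 * v * (u ^ 2 - v ^ 2) = V at *
    rcases hs with rfl | rfl <;> omega

/-! ### Descent for the sum of two cubes -/

theorem Int.isCoprime_sub_add {u v : ℤ} (h : IsCoprime u v) (hodd : Odd (u + v)) :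
    IsCoprime (u - v) (u + v) := by
  have h2 : IsCoprime (2 : ℤ) (u + v) := by
    rwa [Prime.coprime_iff_not_dvd Int.prime_two, ← even_iff_two_dvd, Int.not_even_iff_odd]
  have h1 : IsCoprime (2 * u) (u + v) :=
    h2.mul_left (by simpa [add_comm] using h.add_mul_left_right 1)
  have := h1.add_mul_right_left (-1)
  rwa [show 2 * u + -1 * (u + v) = u - v by ring] at this

theorem Int.isCoprime_sq_add {p q : ℤ} (n : ℤ) (h : IsCoprime p q) (hn : IsCoprime p n) :
    IsCoprime p (p ^ 2 + n * q ^ 2) := by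
  have := (hn.mul_right (h.pow_right (n := 2))).add_mul_left_right p
  rwa [show n * q ^ 2 + p * p = p ^ 2 + n * q ^ 2 by ring] at this

/-- If the product `u * (u - v) * (u + v)` of pairwise coprime factors is a cube, so is
each factor. -/
theorem Int.exists_cubes_of_mul_sub_mul_add {u v c : ℤ} (h : IsCoprime u v) (hodd : Odd (u + v))
    (hc : u * ((u - v) * (u + v)) = c ^ 3) :
    ∃ t r s : ℤ, u = t ^ 3 ∧ u - v = r ^ 3 ∧ u + v = s ^ 3 ∧ IsCoprime r s := by
  have h3 : Odd 3 := by decide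
  have hcop := Int.isCoprime_sub_add h hodd
  have hu : IsCoprime u ((u - v) * (u + v)) := by
    refine IsCoprime.mul_right ?_ ?_
    · have := h.neg_right.add_mul_left_right 1
      rwa [show -v + u * 1 = u - v by ring] at this
    · have := h.add_mul_left_right 1
      rwa [show v + u * 1 = u + v by ring] at this
  obtain ⟨⟨t, ht⟩, ⟨w, hw⟩⟩ := Int.eq_pow_of_mul_eq_pow_odd hu h3 hc
  obtain ⟨⟨r, hr⟩, ⟨s, hs⟩⟩ := Int.eq_pow_of_mul_eq_pow_odd hcop h3 hw
  refine ⟨t, r, s, ht, hr, hs, ?_⟩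
  rw [hr, hs] at hcop
  exact (IsCoprime.pow_iff (by norm_num) (by norm_num)).1 hcop

/-- Makes the descent strict: `|t| ^ 3 ≤ |p| < |p| (p ^ 2 + 3 q ^ 2) = |z| ^ 3`. -/
theorem Int.natAbs_lt_of_cube_dvd {p q t z : ℤ} (hp : p ≠ 0) (hq : q ≠ 0) (ht : t ^ 3 ∣ p)
    (h : p * (p ^ 2 + 3 * q ^ 2) = z ^ 3) : t.natAbs < z.natAbs := by
  refine lt_of_pow_lt_pow_left₀ 3 (Nat.zero_le _) ?_
  rw [← Int.natAbs_pow, ← Int.natAbs_pow, ← h, Int.natAbs_mul]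
  have h1 : (t ^ 3).natAbs ≤ p.natAbs :=
    Nat.le_of_dvd (Int.natAbs_pos.2 hp) (Int.natAbs_dvd_natAbs.2 ht)
  have h2 : 1 < (p ^ 2 + 3 * q ^ 2).natAbs := by
    have := sq_pos_of_ne_zero hp
    have := sq_pos_of_ne_zero hq
    omega
  have h3 := Int.natAbs_pos.2 hp
  nlinarith

/-- Euler: coprime integer solutions of `x ^ 3 + y ^ 3 = 2 * z ^ 3` are trivial. -/
theorem Int.eq_or_eq_zero_of_cube_add_cube_eq_two_mul_cube (x y z : ℤ) (hxy : IsCoprime x y)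
    (h : x ^ 3 + y ^ 3 = 2 * z ^ 3) : x = y ∨ z = 0 := by
  have hpar : Even (x + y) := by
    have h1 : Even (x ^ 3 + y ^ 3) := h ▸ even_two_mul _
    simpa [Int.even_add, Int.even_pow] using h1
  have hx : Odd x := by
    rw [← Int.not_even_iff_odd]
    intro hx
    have hy : Even y := by simpa [Int.even_add, hx] using hpar
    exact Int.prime_two.not_isUnit (hxy.isUnit_of_dvd' hx.two_dvd hy.two_dvd)
  obtain ⟨p, hp⟩ := hpar
  obtain ⟨q, rfl⟩ : ∃ q, x = p + q := ⟨x - p, by ring⟩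
  obtain rfl : y = p - q := by linarith
  by_cases hz0 : z = 0
  · exact .inr hz0
  by_cases hq0 : q = 0
  · exact .inl (by simp [hq0])
  have hpz : p * (p ^ 2 + 3 * q ^ 2) = z ^ 3 := by linarith
  have hp0 : p ≠ 0 := by
    rintro rfl
    exact hz0 (pow_eq_zero_iff (n := 3) (by norm_num) |>.1 (by simpa using hpz.symm))
  have hpq : IsCoprime p q := by
    obtain ⟨r, s, hrs⟩ := hxy
    exact ⟨r + s, r - s, by linarith⟩
  have h3 : Odd 3 := by decide
  by_cases hd : 3 ∣ p
  · obtain ⟨p, rfl⟩ := hd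
    have hq3 : ¬ 3 ∣ q := fun hq =>
      Int.prime_three.not_isUnit (hpq.isUnit_of_dvd' (dvd_mul_right _ _) hq)
    obtain ⟨w, rfl⟩ : 3 ∣ z := Int.prime_three.dvd_of_dvd_pow
      (Dvd.intro (p * ((3 * p) ^ 2 + 3 * q ^ 2)) (by rw [← hpz]; ring))
    have hpw : p * (3 * p ^ 2 + q ^ 2) = 3 * w ^ 3 := by linarith
    -- The original `p` is thus `9 k`, and Euler's lemma applies to `q ^ 2 + 3 (3 k) ^ 2` with the
    -- roles of `p` and `q` exchanged.
    obtain ⟨k, rfl⟩ : 3 ∣ p := by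
      refine (Int.prime_three.dvd_or_dvd (Dvd.intro _ hpw.symm)).resolve_right fun hd => hq3 ?_
      exact Int.prime_three.dvd_of_dvd_pow ((Int.dvd_add_right ⟨_, rfl⟩).1 hd)
    have hkw : k * (k ^ 2 * 27 + q ^ 2) = w ^ 3 := by linarith
    have hqk : IsCoprime q (3 * k) := hpq.symm.of_mul_right_right
    have hkq : IsCoprime k (k ^ 2 * 27 + q ^ 2) := by
      have := (hqk.of_mul_right_right.symm.pow_right (n := 2)).add_mul_left_right (k * 27)
      rwa [show q ^ 2 + k * (k * 27) = k ^ 2 * 27 + q ^ 2 by ring] at this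
    obtain ⟨⟨c, hc⟩, ⟨m, hm⟩⟩ := Int.eq_pow_of_mul_eq_pow_odd hkq h3 hkw
    have hodd : Odd (q + 3 * k) := by
      have : q + 3 * k = (3 * (3 * k) + q) - 2 * (3 * k) := by ring
      rw [this]
      exact hx.sub_even (even_two_mul _)
    obtain ⟨u, v, hu, hv⟩ := exists_of_sq_add_three_mul_sq_eq_cube hqk hodd hq3
      (m := m) (by rw [← hm]; ring)
    have hk : k = v * (u ^ 2 - v ^ 2) := by linarith
    have hvu : IsCoprime v u := by
      rw [hu, hk] at hqk
      exact hqk.of_mul_right_right.of_mul_right_left.of_mul_left_left.symm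
    have hvuodd : Odd (v + u) := by
      rw [hu, hk] at hodd
      revert hodd
      simp only [← Int.not_even_iff_odd, Int.even_add, Int.even_sub, Int.even_mul, Int.even_pow]
      grind
    obtain ⟨t, r, s, ht, hr, hs, hrs⟩ := Int.exists_cubes_of_mul_sub_mul_add (c := -c) hvu hvuodd
      (by linear_combination hk - hc)
    have hlt : t.natAbs < (3 * w).natAbs := by
      refine Int.natAbs_lt_of_cube_dvd hp0 hq0 ?_ hpz
      rw [← ht, hk]
      exact ⟨3 * (3 * (u ^ 2 - v ^ 2)), by ring⟩
    -- The smaller solution is `(v - u) + (v + u) = 2 v`, all three being cubes.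
    rcases Int.eq_or_eq_zero_of_cube_add_cube_eq_two_mul_cube r s t hrs
      (by rw [← hr, ← hs, ← ht]; ring) with rfl | rfl
    · refine absurd ?_ hq0
      rw [hu, show u = 0 by linarith]; ring
    · refine absurd ?_ hp0
      rw [hk, ht]; ring
  · have hp3 : IsCoprime p 3 := ((Prime.coprime_iff_not_dvd Int.prime_three).2 hd).symm
    obtain ⟨⟨c, hc⟩, ⟨m, hm⟩⟩ :=
      Int.eq_pow_of_mul_eq_pow_odd (Int.isCoprime_sq_add 3 hpq hp3) h3 hpz
    obtain ⟨u, v, hu, hv⟩ := exists_of_sq_add_three_mul_sq_eq_cube hpq hx hd hm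
    have huv : IsCoprime u (3 * v) := by
      rw [hu, hv] at hpq
      exact hpq.of_mul_right_left.of_mul_left_left
    have huvodd : Odd (u + 3 * v) := by
      rw [hu, hv] at hx
      revert hx
      simp only [← Int.not_even_iff_odd, Int.even_add, Int.even_sub, Int.even_mul, Int.even_pow]
      grind
    obtain ⟨t, r, s, ht, hr, hs, hrs⟩ := Int.exists_cubes_of_mul_sub_mul_add (c := c) huv huvodd
      (by linear_combination hc - hu)
    have hlt : t.natAbs < z.natAbs := by
      refine Int.natAbs_lt_of_cube_dvd hp0 hq0 ?_ hpz
      rw [← ht, hu]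
      exact dvd_mul_right _ _
    -- Here it is `(u - 3 v) + (u + 3 v) = 2 u`.
    rcases Int.eq_or_eq_zero_of_cube_add_cube_eq_two_mul_cube r s t hrs
      (by rw [← hr, ← hs, ← ht]; ring) with rfl | rfl
    · refine absurd ?_ hq0
      rw [hv, show v = 0 by linarith]; ring
    · refine absurd ?_ hp0
      rw [hu, ht]; ring
termination_by z.natAbs
-- Application to triangular numbers
/-- The only cubic triangular number with positive index has index `1`. -/
theorem eq_one_of_triangular_eq_cube {n m : ℕ} (hn : 0 < n) (h : triangular n = m ^ 3) :
    n = 1 := by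
  have h2 : n * (n + 1) = 2 * m ^ 3 := by rw [← h, two_mul_triangular]
  have hco : IsCoprime ((n : ℤ)) (n + 1) := ⟨-1, 1, by ring⟩
  have h3 : Odd 3 := by decide
  have hone (a b : ℤ) (ha : 0 < a ^ 3) (hb : b ≠ 0) (ε : ℤ) (hε : ε = 1 ∨ ε = -1)
      (hab : a ^ 3 + ε = 2 * b ^ 3) : a ^ 3 = 1 := by
    have ha0 : 0 < a := by rwa [Odd.pow_pos_iff h3] at ha
    have hcop : IsCoprime a ε := by
      rcases hε with rfl | rfl
      · exact isCoprime_one_right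
      · exact isCoprime_one_right.neg_right
    have hε3 : ε ^ 3 = ε := by rcases hε with rfl | rfl <;> norm_num
    rcases Int.eq_or_eq_zero_of_cube_add_cube_eq_two_mul_cube a ε b hcop (by rw [hε3, hab])
      with rfl | rfl
    · rcases hε with rfl | rfl
      · norm_num
      · omega
    · exact absurd rfl hb
  rcases Nat.even_or_odd' n with ⟨k, hk | hk⟩
  · have hk2 : (k : ℤ) * (n + 1) = m ^ 3 := by
      have : k * (n + 1) = m ^ 3 := by
        have : 2 * (k * (n + 1)) = 2 * m ^ 3 := by rw [← h2, ← mul_assoc, ← hk]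
        omega
      exact_mod_cast this
    have hcop : IsCoprime (k : ℤ) (n + 1) := by
      rw [hk] at hco ⊢
      push_cast at hco ⊢
      exact hco.of_mul_left_right
    obtain ⟨⟨b, hb⟩, ⟨a, ha⟩⟩ := Int.eq_pow_of_mul_eq_pow_odd hcop h3 hk2
    -- `n + 1 = a ^ 3 = 1` contradicts `0 < n`, so even `n` is impossible.
    have := hone a b (by omega) (by rintro rfl; norm_num at hb; omega) (-1) (.inr rfl) (by omega)
    omega
  · have hk2 : (n : ℤ) * (k + 1) = m ^ 3 := by
      have : n * (k + 1) = m ^ 3 := by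
        have : 2 * (n * (k + 1)) = 2 * m ^ 3 := by
          rw [← h2, show n + 1 = 2 * (k + 1) by omega]; ring
        omega
      exact_mod_cast this
    have hcop : IsCoprime (n : ℤ) (k + 1) := by
      rw [show (n : ℤ) + 1 = 2 * (k + 1) by rw [hk]; push_cast; ring] at hco
      exact hco.of_mul_right_right
    obtain ⟨⟨a, ha⟩, ⟨b, hb⟩⟩ := Int.eq_pow_of_mul_eq_pow_odd hcop h3 hk2
    have := hone a b (by omega) (by rintro rfl; norm_num at hb; omega) 1 (.inl rfl) (by omega)
    omega

theorem corollary2 :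
    (∀ N : ℕ, IsCubicTriangular N ↔ N = 1) ∧
    (∀ n m : ℕ, 0 < n → 0 < m → (triangular n = m ^ 3 ↔ n = 1 ∧ m = 1)) := by
  have h1 : triangular 1 = 1 := rfl
  refine ⟨fun N => ⟨?_, ?_⟩, fun n m hn _ => ⟨fun h => ?_, ?_⟩⟩
  · rintro ⟨hN, ⟨n, rfl⟩, ⟨m, hm⟩⟩
    have hn : 0 < n := Nat.pos_of_ne_zero (by rintro rfl; simp [triangular] at hN)
    rw [eq_one_of_triangular_eq_cube hn hm, h1]
  · rintro rfl
    exact ⟨one_pos, ⟨1, rfl⟩, ⟨1, rfl⟩⟩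
  · obtain rfl := eq_one_of_triangular_eq_cube hn h
    refine ⟨rfl, ?_⟩
    rw [h1] at h
    exact (Nat.pow_eq_one.1 h.symm).resolve_right (by norm_num)
  · rintro ⟨rfl, rfl⟩
    rfl
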